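/- Let $n,k$ be integers with $1\le k\le n-1$. A star body in $\mathbb{R}^n$ is a closed bounded set $K$ with the origin in its interior such that every straight line through the origin crosses the boundary of $K$ at exactly two points different from the origin and the boundary of $K$ is continuous, i.e. the radius $r_K(\xi)=\max\{t\ge 0: t\xi\in K\}$ is a continuous function of $\xi\in S^{n-1}$. The radial $k$-sum of finitely many star bodies $K_1,\dots,K_m$ ($m\ge1$) is the star body $L$ with $r_L^k(\xi)=\sum_{i=1}^m r_{K_i}^k(\xi)$ for all $\xi\in S^{n-1}$. The class $\mathcal{BP}_k^n$ of generalized $k$-intersection bodies is the closure, within the origin-symmetric star bodies in $\mathbb{R}^n$ and with respect to the radial metric $\rho(K,L)=\sup_{\xi\in S^{n-1}}|r_K(\xi)-r_L(\xi)|$, of the set of radial $k$-sums of finite nonempty collections of origin-symmetric ellipsoids. For an origin-symmetric star body $K$ put $$\mathrm{o.v.r.}(K,\mathcal{BP}_k^n)=\inf\left\{\left(\frac{|D|}{|K|}\right)^{1/n}:\ K\subset D,\ D\in\mathcal{BP}_k^n\right\},$$ where $|\cdot|$ denotes volume of the appropriate dimension. Let $c_{n,k}=|B_2^n|^{\frac{n-k}{n}}/|B_2^{n-k}|$,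 where $B_2^m$ is the unit Euclidean ball in $\mathbb{R}^m$, and let $Gr_{n-k}$ be the Grassmannian of $(n-k)$-dimensional linear subspaces of $\mathbb{R}^n$. Let $K$ be an origin-symmetric star body in $\mathbb{R}^n$, and let $\mu$ be a measure with non-negative even continuous density $f$ on $K$; write $\mu(K)=\int_K f$ and, for $H\in Gr_{n-k}$, $\mu(K\cap H)=\int_{K\cap H}f$, the integral of the restriction of $f$ to $H$ with respect to Lebesgue measure in $H$. Then the maximum of $\mu(K\cap H)$ over $H\in Gr_{n-k}$ is attained, and $$\mu(K)\ \le\ \left(\mathrm{o.v.r.}(K,\mathcal{BP}_k^n)\right)^k\ \frac{n}{n-k}\ c_{n,k}\ \max_{H\in Gr_{n-k}}\mu(K\cap H)\ |K|^{k/n}.$$ -/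

import Mathlib

open Set MeasureTheory Metric

noncomputable section

/-- Euclidean space `ℝⁿ`. -/
abbrev Euc (n : ℕ) : Type := EuclideanSpace ℝ (Fin n)

/-- The radius `r_K(ξ)` of `K` in the direction `ξ`. -/
def radialFunction {n : ℕ} (K : Set (Euc n)) (ξ : Euc n) : ℝ :=
  sSup {t : ℝ | 0 ≤ t ∧ t • ξ ∈ K}

/-- A star body: a closed bounded set with the origin in its interior, such that every straight line
through the origin meets the boundary in exactly two points different from the origin, and whose
boundary is continuous (the radius is a continuous function of the direction). -/
structure IsStarBody {n : ℕ} (K : Set (Euc n)) : Prop where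
  isClosed : IsClosed K
  isBounded : Bornology.IsBounded K
  zero_mem_interior : (0 : Euc n) ∈ interior K
  line_boundary : ∀ ξ : Euc n, ξ ≠ 0 →
    {x : Euc n | x ∈ frontier K ∧ x ≠ 0 ∧ ∃ t : ℝ, x = t • ξ}.ncard = 2
  continuous_boundary : ContinuousOn (radialFunction K) (sphere (0 : Euc n) 1)

/-- An origin-symmetric star body. -/
def IsSymmStarBody {n : ℕ} (K : Set (Euc n)) : Prop :=
  IsStarBody K ∧ ∀ x ∈ K, -x ∈ K

/-- An origin-symmetric (solid, nondegenerate) ellipsoid. -/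
def IsSymmEllipsoid {n : ℕ} (K : Set (Euc n)) : Prop :=
  ∃ T : Euc n ≃ₗ[ℝ] Euc n, K = T '' closedBall (0 : Euc n) 1

/-- `L` is the radial `k`-sum of the finite family `E 0, …, E (m - 1)`: the star body whose radius
in each direction satisfies `r_L(ξ)^k = ∑ i, r_{E i}(ξ)^k`. -/
def IsRadialSum {n : ℕ} (k : ℕ) {m : ℕ} (E : Fin m → Set (Euc n)) (L : Set (Euc n)) : Prop :=
  IsStarBody L ∧ ∀ ξ ∈ sphere (0 : Euc n) 1,
    radialFunction L ξ ^ k = ∑ i, radialFunction (E i) ξ ^ k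

/-- The radial metric `ρ(K, L)`, the supremum over the unit sphere of `|r_K - r_L|`. -/
def radialDist {n : ℕ} (K L : Set (Euc n)) : ℝ :=
  ⨆ ξ : sphere (0 : Euc n) 1, |radialFunction K ξ - radialFunction L ξ|

/-- The class `BP_k^n` of generalized `k`-intersection bodies: the closure, in the radial metric on
origin-symmetric star bodies, of the radial `k`-sums of finite (nonempty) collections of
origin-symmetric ellipsoids. -/
def IsGenIntersectionBody {n : ℕ} (k : ℕ) (D : Set (Euc n)) : Prop :=
  IsSymmStarBody D ∧ ∀ ε : ℝ, 0 < ε →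
    ∃ (m : ℕ) (E : Fin m → Set (Euc n)) (L : Set (Euc n)),
      0 < m ∧ (∀ i, IsSymmEllipsoid (E i)) ∧ IsRadialSum k E L ∧ radialDist D L < ε

/-- The volume `|A|` of a subset of `ℝⁿ`, as a real number. -/
def vol {n : ℕ} (A : Set (Euc n)) : ℝ := (volume A).toReal

/-- The outer volume ratio distance from `K` to the class `BP_k^n`. -/
def outerVolumeRatio {n : ℕ} (k : ℕ) (K : Set (Euc n)) : ℝ :=
  sInf {v : ℝ | ∃ D : Set (Euc n), K ⊆ D ∧ IsGenIntersectionBody k D ∧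
    v = (vol D / vol K) ^ (1 / (n : ℝ))}

/-- The constant `c_{n,k} = |B_2^n|^((n-k)/n) / |B_2^(n-k)|`. -/
def cConst (n k : ℕ) : ℝ :=
  vol (closedBall (0 : Euc n) 1) ^ (((n : ℝ) - (k : ℝ)) / (n : ℝ)) /
    vol (closedBall (0 : Euc (n - k)) 1)

/-- `μ(B) = ∫_B f`, for the measure `μ` with density `f`. -/
def densityMeasure {n : ℕ} (f : Euc n → ℝ) (B : Set (Euc n)) : ℝ :=
  ∫ x in B, f x

/-- Lebesgue measure in a subspace `H`: the Haar measure giving mass one to the cube spanned by an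
orthonormal basis of `H`. (It is spelled out because `volume` on the subtype `H` could also be read
as the restriction of the ambient volume.) -/
def subspaceVolume {n : ℕ} (H : Submodule ℝ (Euc n)) : Measure H :=
  (stdOrthonormalBasis ℝ H).toBasis.addHaar

/-- `μ(B ∩ H) = ∫_{B ∩ H} f`, the integral over `B ∩ H` of the restriction of `f` to `H` with
respect to Lebesgue measure in `H`. -/
def sectionMeasure {n : ℕ} (f : Euc n → ℝ) (B : Set (Euc n)) (H : Submodule ℝ (Euc n)) : ℝ :=
  ∫ x in {x : H | (x : Euc n) ∈ B}, f x ∂(subspaceVolume H)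

end

/-! Extend the radius to all vectors as a function homogeneous of degree -1. If `K ⊆ D`, then `r_D ≥
1` on `K` away from the origin, so `μ(K) ≤ ∫ r_D^k F` with `F = f · 1_K`. It remains to bound this
weighted integral by sections of `F`.

For an ellipsoid `D = T(B)` the weight is `‖T⁻¹x‖^(-k)`. After substituting `x = Ty`, integration
against `‖y‖^(-k)` is a constant times averaging over random `(n-k)`-dimensional sections
(`exists_lintegral_eq_average`). Each section of `F ∘ T` is a Jacobian times a section of `F`, hence
at most that Jacobian times `M`. For the indicator of the unit ball the same Jacobian appears, times
exactly `|B_2^(n-k)|`. Comparing the two gives `|B_2^(n-k)| ∫ r_D^k F ≤ M ∫_B r_D^k` with no unknown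
constant (`lintegral_ellipsoid_mul_le`). This is linear in `r_D^k` and stable under radial limits,
so it holds on the whole class (`IsGenIntersectionBody.lintegral_mul_le`).

Polar coordinates and Hölder on the sphere bound `∫_B r_D^k` by a multiple of `|D|^(k/n)`; taking
the infimum over `D` produces the outer volume ratio. The maximum over sections exists because the
orthogonal group is compact and the section integral is continuous on it: the boundary of a star
body is null in every subspace (`IsStarBody.volume_frontier_comp`). -/

noncomputable section

open scoped ENNReal Pointwise

/-! ### Radial functions of star bodies, balls and ellipsoids -/

section StarBody

variable {n : ℕ} {K : Set (Euc n)}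

theorem radialFunction_zero : radialFunction K 0 = 0 := by
  unfold radialFunction
  by_cases h : (0 : Euc n) ∈ K
  · have : {t : ℝ | 0 ≤ t ∧ t • (0 : Euc n) ∈ K} = Ici 0 := by ext t; simp [h]
    -- The real supremum of an unbounded set is 0 by convention, hence radius 0 at the origin.
    rw [this, Real.sSup_of_not_bddAbove (not_bddAbove_Ici 0)]
  · simp [h]

theorem radialFunction_smul {s : ℝ} (hs : 0 < s) (x : Euc n) :
    radialFunction K (s • x) = s⁻¹ * radialFunction K x := by
  unfold radialFunction
  rw [← smul_eq_mul, ← Real.sSup_smul_of_nonneg (inv_nonneg.2 hs.le)]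
  congr 1
  ext t
  rw [Set.mem_inv_smul_set_iff₀ hs.ne']
  simp only [mem_ofPred_eq, smul_smul, smul_eq_mul, mul_comm s t, mul_nonneg_iff_of_pos_right hs]

theorem IsStarBody.radialFunction_props (hK : IsStarBody K) {x : Euc n} (hx : x ≠ 0) :
    0 < radialFunction K x ∧ radialFunction K x • x ∈ frontier K ∧
      ∀ t, 0 ≤ t → t • x ∈ K → t ≤ radialFunction K x := by
  set A : Set ℝ := {t : ℝ | 0 ≤ t ∧ t • x ∈ K} with hA
  have hcont : Continuous fun t : ℝ => t • x := by fun_prop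
  have hbdd : BddAbove A := by
    obtain ⟨R, hR⟩ := hK.isBounded.exists_norm_le
    refine ⟨R / ‖x‖, fun t ht => ?_⟩
    have := hR _ ht.2
    rw [norm_smul, Real.norm_of_nonneg ht.1] at this
    rwa [le_div_iff₀ (norm_pos_iff.2 hx)]
  have hcl : IsClosed A := isClosed_Ici.inter (hK.isClosed.preimage hcont)
  have h0 : (0 : ℝ) ∈ A := ⟨le_rfl, by simpa using interior_subset hK.zero_mem_interior⟩
  have hmem : sSup A ∈ A := hcl.csSup_mem ⟨0, h0⟩ hbdd
  have key : ∀ t ∈ A, t • x ∈ interior K → t < sSup A := by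
    intro t ht hti
    have hopen : IsOpen ((fun t : ℝ => t • x) ⁻¹' interior K) := isOpen_interior.preimage hcont
    obtain ⟨ε, hε, hball⟩ := Metric.isOpen_iff.1 hopen t hti
    have : t + ε / 2 ∈ A := by
      refine ⟨by linarith [ht.1], interior_subset (hball ?_)⟩
      rw [mem_ball, Real.dist_eq]
      rw [show t + ε / 2 - t = ε / 2 by ring, abs_of_pos (by linarith)]
      linarith
    linarith [le_csSup hbdd this]
  refine ⟨key 0 h0 (by simpa using hK.zero_mem_interior), ?_, fun t h1 h2 => le_csSup hbdd ⟨h1, h2⟩⟩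
  rw [hK.isClosed.frontier_eq]
  exact ⟨hmem.2, fun hi => lt_irrefl _ (key _ hmem hi)⟩

theorem IsStarBody.radialFunction_pos (hK : IsStarBody K) {x : Euc n} (hx : x ≠ 0) :
    0 < radialFunction K x := (hK.radialFunction_props hx).1

theorem IsStarBody.radialFunction_nonneg (hK : IsStarBody K) (x : Euc n) :
    0 ≤ radialFunction K x := by
  rcases eq_or_ne x 0 with rfl | hx
  · rw [radialFunction_zero]
  · exact (hK.radialFunction_pos hx).le

/-- The extreme points of `K` on the two opposite rays already exhaust the two boundary points
allowed on the line. The segment from the origin up to the radius thus avoids the boundary, and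
being connected it stays in the interior. -/
theorem IsStarBody.smul_mem_interior_of_lt (hK : IsStarBody K) {x : Euc n} (hx : x ≠ 0) {t : ℝ}
    (h0 : 0 ≤ t) (ht : t < radialFunction K x) : t • x ∈ interior K := by
  obtain ⟨hpos, hfr, -⟩ := hK.radialFunction_props hx
  obtain ⟨hpos', hfr', -⟩ := hK.radialFunction_props (neg_ne_zero.2 hx)
  set r := radialFunction K x
  set r' := radialFunction K (-x)
  have hno : ∀ s, 0 < s → s < r → s • x ∉ frontier K := by
    intro s hs hsr hsf
    obtain ⟨p, q, -, hpq⟩ := Set.ncard_eq_two.1 (hK.line_boundary x hx)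
    have mem : ∀ s : ℝ, s ≠ 0 → s • x ∈ frontier K → s • x = p ∨ s • x = q := by
      intro s hs hf
      have : s • x ∈ ({p, q} : Set (Euc n)) := by
        rw [← hpq]
        exact ⟨hf, smul_ne_zero hs hx, s, rfl⟩
      simpa using this
    have inj : ∀ a b : ℝ, a • x = b • x → a = b := fun a b h => smul_left_injective ℝ hx h
    have e1 := mem s hs.ne' hsf
    have e2 := mem r hpos.ne' hfr
    have e3 := mem (-r') (neg_ne_zero.2 hpos'.ne') (by simpa using hfr')
    rcases e1 with e1 | e1 <;> rcases e2 with e2 | e2 <;> rcases e3 with e3 | e3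
    all_goals first
      | (have := inj _ _ (e1.trans e2.symm); linarith)
      | (have := inj _ _ (e1.trans e3.symm); linarith)
      | (have := inj _ _ (e2.trans e3.symm); linarith)
  have hcont : Continuous fun t : ℝ => t • x := by fun_prop
  have hsub : Ico 0 r ⊆ (fun t : ℝ => t • x) ⁻¹' interior K := by
    refine isPreconnected_Ico.subset_left_of_subset_union
      (v := (fun t : ℝ => t • x) ⁻¹' Kᶜ) (isOpen_interior.preimage hcont)
      (hK.isClosed.isOpen_compl.preimage hcont) ?_ ?_ ?_
    · exact Disjoint.preimage _ (disjoint_compl_right.mono_left interior_subset)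
    · intro s hs
      by_contra hc
      simp only [mem_union, mem_preimage, mem_compl_iff, not_or, not_not] at hc
      have hf : s • x ∈ frontier K := by rw [hK.isClosed.frontier_eq]; exact ⟨hc.2, hc.1⟩
      rcases hs.1.eq_or_lt with h | h
      · exact hc.1 (by simpa [← h] using hK.zero_mem_interior)
      · exact hno s h hs.2 hf
    · exact ⟨0, ⟨le_rfl, hpos⟩, by simpa using hK.zero_mem_interior⟩
  exact hsub ⟨h0, ht⟩

theorem IsStarBody.smul_mem_iff (hK : IsStarBody K) {x : Euc n} (hx : x ≠ 0) {t : ℝ}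
    (h0 : 0 ≤ t) : t • x ∈ K ↔ t ≤ radialFunction K x := by
  refine ⟨(hK.radialFunction_props hx).2.2 t h0, fun h => ?_⟩
  rcases h.eq_or_lt with rfl | h
  · exact hK.isClosed.frontier_subset (hK.radialFunction_props hx).2.1
  · exact interior_subset (hK.smul_mem_interior_of_lt hx h0 h)

theorem IsStarBody.one_le_radialFunction (hK : IsStarBody K) {x : Euc n} (hx : x ≠ 0)
    (hxK : x ∈ K) : 1 ≤ radialFunction K x :=
  (hK.smul_mem_iff hx zero_le_one).1 (by simpa using hxK)

theorem IsStarBody.smul_mem_interior (hK : IsStarBody K) {x : Euc n} (hxK : x ∈ K) {s : ℝ}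
    (h0 : 0 ≤ s) (hs : s < 1) : s • x ∈ interior K := by
  rcases eq_or_ne x 0 with rfl | hx
  · simpa using hK.zero_mem_interior
  · exact hK.smul_mem_interior_of_lt hx h0 (hs.trans_le (hK.one_le_radialFunction hx hxK))

theorem radialFunction_eq_inv_norm_mul {x : Euc n} (hx : x ≠ 0) :
    radialFunction K x = ‖x‖⁻¹ * radialFunction K (‖x‖⁻¹ • x) := by
  have hx' : 0 < ‖x‖ := norm_pos_iff.2 hx
  rw [← radialFunction_smul hx', smul_smul, mul_inv_cancel₀ hx'.ne', one_smul]

theorem inv_norm_smul_mem_sphere {x : Euc n} (hx : x ≠ 0) :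
    ‖x‖⁻¹ • x ∈ sphere (0 : Euc n) 1 := by
  rw [mem_sphere_zero_iff_norm, norm_smul, norm_inv, norm_norm,
    inv_mul_cancel₀ (norm_ne_zero_iff.2 hx)]

theorem IsStarBody.continuousOn_radialFunction (hK : IsStarBody K) :
    ContinuousOn (radialFunction K) {0}ᶜ := by
  have h1 : ContinuousOn (fun x : Euc n => ‖x‖⁻¹) {0}ᶜ :=
    continuous_norm.continuousOn.inv₀ fun x hx => norm_ne_zero_iff.2 hx
  have h2 : ContinuousOn (fun x : Euc n => ‖x‖⁻¹ * radialFunction K (‖x‖⁻¹ • x)) {0}ᶜ :=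
    h1.mul (hK.continuous_boundary.comp (h1.smul continuousOn_id)
      fun x hx => inv_norm_smul_mem_sphere hx)
  exact h2.congr fun x hx => radialFunction_eq_inv_norm_mul hx

theorem IsStarBody.measurable_radialFunction (hK : IsStarBody K) :
    Measurable (radialFunction K) := by
  refine measurable_of_isOpen fun U hU => ?_
  obtain ⟨V, hV, hVU⟩ := (_root_.continuousOn_iff'.1 hK.continuousOn_radialFunction) U hU
  have hmeas : MeasurableSet (radialFunction K ⁻¹' U ∩ {0}ᶜ) := by
    rw [hVU]
    exact hV.measurableSet.inter (measurableSet_singleton _).compl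
  have : radialFunction K ⁻¹' U =
      (radialFunction K ⁻¹' U ∩ {0}ᶜ) ∪ (radialFunction K ⁻¹' U ∩ {0}) := by
    rw [← inter_union_distrib_left, compl_union_self, inter_univ]
  rw [this]
  exact hmeas.union ((Set.finite_singleton _).inter_of_right _).measurableSet

theorem radialFunction_ellipsoid (T : Euc n ≃ₗ[ℝ] Euc n) (x : Euc n) :
    radialFunction (T '' closedBall (0 : Euc n) 1) x = ‖T.symm x‖⁻¹ := by
  rcases eq_or_ne x 0 with rfl | hx
  · simp [radialFunction_zero]
  have hpos : 0 < ‖T.symm x‖ := norm_pos_iff.2 (by simpa using hx)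
  have : {t : ℝ | 0 ≤ t ∧ t • x ∈ T '' closedBall (0 : Euc n) 1} = Icc 0 ‖T.symm x‖⁻¹ := by
    ext t
    simp only [mem_ofPred_eq, mem_Icc, and_congr_right_iff]
    intro ht
    rw [LinearEquiv.image_eq_preimage_symm, mem_preimage, map_smul, mem_closedBall_zero_iff,
      norm_smul, Real.norm_of_nonneg ht, ← one_div, le_div_iff₀ hpos]
  rw [radialFunction, this, csSup_Icc (by positivity)]

theorem closedBall_eq_image_smul {R : ℝ} (hR : 0 < R) :
    closedBall (0 : Euc n) R =
      LinearEquiv.smulOfNeZero ℝ (Euc n) R hR.ne' '' closedBall (0 : Euc n) 1 := by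
  have h := smul_unitClosedBall_of_nonneg (E := Euc n) hR.le
  rw [← h, ← Set.image_smul]
  rfl

theorem radialFunction_closedBall {R : ℝ} (hR : 0 < R) (x : Euc n) :
    radialFunction (closedBall (0 : Euc n) R) x = R * ‖x‖⁻¹ := by
  rw [closedBall_eq_image_smul hR, radialFunction_ellipsoid,
    show (LinearEquiv.smulOfNeZero ℝ (Euc n) R hR.ne').symm x = R⁻¹ • x from rfl,
    norm_smul, norm_inv, Real.norm_of_nonneg hR.le, mul_inv, inv_inv]

theorem isSymmStarBody_closedBall {R : ℝ} (hR : 0 < R) :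
    IsSymmStarBody (closedBall (0 : Euc n) R) := by
  refine ⟨⟨isClosed_closedBall, isBounded_closedBall, ?_, fun ξ hξ => ?_, ?_⟩, fun x hx => ?_⟩
  · rw [interior_closedBall _ hR.ne']
    exact mem_ball_self hR
  · have hξ' : 0 < ‖ξ‖ := norm_pos_iff.2 hξ
    have hset : {x : Euc n | x ∈ frontier (closedBall (0 : Euc n) R) ∧ x ≠ 0 ∧
        ∃ t : ℝ, x = t • ξ} = {(R / ‖ξ‖) • ξ, (-(R / ‖ξ‖)) • ξ} := by
      rw [frontier_closedBall _ hR.ne']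
      ext x
      simp only [mem_ofPred_eq, mem_insert_iff, mem_singleton_iff, mem_sphere_zero_iff_norm]
      constructor
      · rintro ⟨h1, -, t, rfl⟩
        rw [norm_smul, Real.norm_eq_abs, ← eq_div_iff hξ'.ne'] at h1
        rcases eq_or_eq_neg_of_abs_eq h1 with h | h
        · left; rw [h]
        · right; rw [h]
      · have hd : 0 < R / ‖ξ‖ := by positivity
        rintro (rfl | rfl)
        · refine ⟨?_, smul_ne_zero hd.ne' hξ, _, rfl⟩
          rw [norm_smul, Real.norm_of_nonneg hd.le, div_mul_cancel₀ _ hξ'.ne']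
        · refine ⟨?_, smul_ne_zero (neg_ne_zero.2 hd.ne') hξ, _, rfl⟩
          rw [norm_smul, norm_neg, Real.norm_of_nonneg hd.le, div_mul_cancel₀ _ hξ'.ne']
    rw [hset]
    refine Set.ncard_pair fun h => ?_
    have h1 := smul_left_injective ℝ hξ h
    have hd : 0 < R / ‖ξ‖ := by positivity
    linarith
  · refine (continuousOn_const (c := R)).congr fun x hx => ?_
    rw [radialFunction_closedBall hR, mem_sphere_zero_iff_norm.1 hx, inv_one, mul_one]
  · simpa using hx

theorem isGenIntersectionBody_closedBall (k : ℕ) {R : ℝ} (hR : 0 < R) :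
    IsGenIntersectionBody k (closedBall (0 : Euc n) R) := by
  refine ⟨isSymmStarBody_closedBall hR, fun ε hε => ⟨1, fun _ => closedBall 0 R, closedBall 0 R,
    one_pos, fun _ => ⟨_, closedBall_eq_image_smul hR⟩,
    ⟨(isSymmStarBody_closedBall hR).1, fun ξ _ => by simp⟩, ?_⟩⟩
  simpa [radialDist] using hε

/-- Closeness in the radial metric gives two-sided multiplicative bounds on the radius. -/
theorem exists_radialDist_lt_imp {D : Set (Euc n)} (hD : IsStarBody D) {η : ℝ} (hη : 0 < η) :
    ∃ ε > 0, ∀ L : Set (Euc n), IsStarBody L → radialDist D L < ε →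
      ∀ x, (1 - η) * radialFunction D x ≤ radialFunction L x ∧
        radialFunction L x ≤ (1 + η) * radialFunction D x := by
  -- The minimum of the radius on the compact sphere turns an additive error `η * δ` into a relative
  -- error `η`.
  obtain ⟨δ, hδ, hδD⟩ : ∃ δ > 0, ∀ x ∈ sphere (0 : Euc n) 1, δ ≤ radialFunction D x := by
    rcases (sphere (0 : Euc n) 1).eq_empty_or_nonempty with h | h
    · exact ⟨1, one_pos, by simp [h]⟩
    · obtain ⟨x, hx, hmin⟩ := (isCompact_sphere (0 : Euc n) 1).exists_isMinOn h
        hD.continuous_boundary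
      exact ⟨_, hD.radialFunction_pos (ne_zero_of_mem_unit_sphere ⟨x, hx⟩), fun y hy => hmin hy⟩
  refine ⟨η * δ, by positivity, fun L hL hdist x => ?_⟩
  rcases eq_or_ne x 0 with rfl | hx
  · simp [radialFunction_zero]
  -- Continuity ensures that the supremum defining the radial distance is over a bounded family, so
  -- that it dominates each value.
  have hcont : Continuous fun ξ : sphere (0 : Euc n) 1 =>
      |radialFunction D ξ - radialFunction L ξ| :=
    (hD.continuous_boundary.domRestrict.sub hL.continuous_boundary.domRestrict).abs
  have hbdd := (isCompact_range hcont).bddAbove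
  have hu := inv_norm_smul_mem_sphere hx
  set u := ‖x‖⁻¹ • x with hu_def
  have h1 : |radialFunction D u - radialFunction L u| ≤ η * δ :=
    (le_ciSup hbdd ⟨u, hu⟩).trans hdist.le
  have h2 : η * δ ≤ η * radialFunction D u := by gcongr; exact hδD u hu
  obtain ⟨h3, h4⟩ := abs_le.1 (h1.trans h2)
  rw [radialFunction_eq_inv_norm_mul hx, radialFunction_eq_inv_norm_mul (K := L) hx, ← hu_def]
  have hx' : 0 ≤ ‖x‖⁻¹ := by positivity
  constructor
  · rw [mul_left_comm]
    exact mul_le_mul_of_nonneg_left (by linarith) hx'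
  · rw [mul_left_comm]
    exact mul_le_mul_of_nonneg_left (by linarith) hx'

/-- For `0 < s < 1` the dilate `s • K` lies in the interior of `K`, so inside the subspace the
interior part has at least `s^m` times the volume of the section; let `s → 1`. -/
theorem IsStarBody.volume_frontier_comp (hK : IsStarBody K) {m : ℕ}
    (A : Euc m →ₗ[ℝ] Euc n) (hA : Function.Injective A) :
    volume {h : Euc m | A h ∈ frontier K} = 0 := by
  have hAc : Continuous A := A.continuous_of_finiteDimensional
  set C : Set (Euc m) := A ⁻¹' K
  set O : Set (Euc m) := A ⁻¹' interior K
  have hOC : O ⊆ C := preimage_mono interior_subset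
  have hO : IsOpen O := isOpen_interior.preimage hAc
  have hCfin : volume C ≠ ∞ := by
    obtain ⟨c, hc, hanti⟩ := A.toContinuousLinearMap.exists_antilipschitzWith
      (LinearMap.ker_eq_bot.2 hA)
    exact (hanti.isBounded_preimage hK.isBounded).measure_lt_top.ne
  have hle : ∀ s : ℝ, 0 < s → s < 1 → ENNReal.ofReal (s ^ m) * volume C ≤ volume O := by
    intro s h0 h1
    have : s • C ⊆ O := by
      rintro _ ⟨x, hx, rfl⟩
      show A (s • x) ∈ interior K
      rw [map_smul]
      exact hK.smul_mem_interior hx h0.le h1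
    calc _ = volume (s • C) := by
          rw [Measure.addHaar_smul_of_nonneg _ h0.le, finrank_euclideanSpace_fin]
      _ ≤ _ := measure_mono this
  have hCO : volume C ≤ volume O := by
    have ht : Filter.Tendsto (fun s : ℝ => ENNReal.ofReal (s ^ m) * volume C)
        (nhdsWithin 1 (Iio 1)) (nhds (ENNReal.ofReal (1 ^ m) * volume C)) := by
      refine ENNReal.Tendsto.mul_const ?_ (Or.inr hCfin)
      refine Filter.Tendsto.mono_left ?_ nhdsWithin_le_nhds
      exact (ENNReal.continuous_ofReal.comp (continuous_pow m)).tendsto 1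
    have := le_of_tendsto ht (b := volume O) ?_
    · simpa using this
    · filter_upwards [Ioo_mem_nhdsLT (show (0 : ℝ) < 1 by norm_num)] with s hs
      exact hle s hs.1 hs.2
  have : {h : Euc m | A h ∈ frontier K} = C \ O := by
    rw [hK.isClosed.frontier_eq]; rfl
  rw [this, measure_sdiff hOC hO.nullMeasurableSet (ne_top_of_le_ne_top hCfin (measure_mono hOC)),
    tsub_eq_zero_of_le hCO]

end StarBody

/-! ### Integrals over subspaces and their linear parametrizations -/

section LinearSections

variable {n m : ℕ}

/-- The isometric parametrization of an `m`-dimensional subspace by `ℝᵐ`. -/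
def subspaceParam (H : Submodule ℝ (Euc n)) (hH : Module.finrank ℝ H = m) : Euc m ≃ₗᵢ[ℝ] H :=
  ((stdOrthonormalBasis ℝ H).reindex (finCongr hH)).repr.symm

theorem map_subspaceParam (H : Submodule ℝ (Euc n)) (hH : Module.finrank ℝ H = m) :
    (volume : Measure (Euc m)).map (subspaceParam H hH) = subspaceVolume H := by
  subst hH
  rw [← (EuclideanSpace.basisFun (Fin _) ℝ).addHaar_eq_volume]
  have := Module.Basis.map_addHaar (EuclideanSpace.basisFun (Fin (Module.finrank ℝ H)) ℝ).toBasis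
    (subspaceParam H rfl).toContinuousLinearEquiv
  refine this.trans ?_
  rw [subspaceVolume]
  congr 1

/-- Two isometric parametrizations differ by an isometry of `ℝᵐ`, which preserves volume. -/
theorem map_eq_subspaceVolume (H : Submodule ℝ (Euc n)) (L : Euc m ≃ₗᵢ[ℝ] H) :
    (volume : Measure (Euc m)).map L = subspaceVolume H := by
  have hH : Module.finrank ℝ H = m := by
    rw [← L.toLinearEquiv.finrank_eq, finrank_euclideanSpace_fin]
  rw [← map_subspaceParam H hH]
  have h := (L.trans (subspaceParam H hH).symm).measurePreserving.map_eq
  conv_rhs => rw [← h]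
  rw [Measure.map_map (subspaceParam H hH).continuous.measurable
    (L.trans (subspaceParam H hH).symm).continuous.measurable]
  congr 1
  ext x
  simp

/-- Scaling of the integral over a subspace under an injective linear parametrization. -/
theorem exists_lintegral_comp_eq (A : Euc m →ₗ[ℝ] Euc n) (hA : Function.Injective A) :
    ∃ c : ℝ≥0∞, c ≠ ∞ ∧ ∃ V : Euc m →ₗᵢ[ℝ] Euc n, ∀ G : Euc n → ℝ≥0∞,
      ∫⁻ h, G (A h) = c * ∫⁻ h, G (V h) := by
  set H := LinearMap.range A
  set e : Euc m ≃ₗ[ℝ] H := LinearEquiv.ofInjective A hA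
  have hH : Module.finrank ℝ H = m := by rw [← e.finrank_eq, finrank_euclideanSpace_fin]
  set L := subspaceParam H hH
  -- `A` factors as the automorphism `B` of `ℝᵐ` followed by an isometric embedding; the scaling
  -- constant is `|det B|⁻¹`.
  set B : Euc m ≃ₗ[ℝ] Euc m := e.trans L.symm.toLinearEquiv
  have hdet : LinearMap.det (B : Euc m →ₗ[ℝ] Euc m) ≠ 0 := B.isUnit_det'.ne_zero
  refine ⟨ENNReal.ofReal |(LinearMap.det (B : Euc m →ₗ[ℝ] Euc m))⁻¹|, ENNReal.ofReal_ne_top,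
    H.subtypeₗᵢ.comp L.toLinearIsometry, fun G => ?_⟩
  have h1 : ∀ h, A h = (L (B h) : Euc n) := fun h => by
    simp only [B, e, LinearEquiv.trans_apply, LinearIsometryEquiv.coe_toLinearEquiv,
      LinearIsometryEquiv.apply_symm_apply]
    rfl
  have h2 := Measure.map_linearMap_addHaar_eq_smul_addHaar (volume : Measure (Euc m)) hdet
  have h3 := lintegral_map_equiv (μ := (volume : Measure (Euc m))) (fun h => G (L h : Euc n))
    B.toContinuousLinearEquiv.toHomeomorph.toMeasurableEquiv
  calc ∫⁻ h, G (A h) = ∫⁻ h, G (L (B h) : Euc n) := by simp_rw [h1]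
    _ = ∫⁻ h, G (L h : Euc n) ∂(volume.map (B : Euc m →ₗ[ℝ] Euc m)) := h3.symm
    _ = _ := by rw [h2, lintegral_smul_measure]; rfl

/-- If every isometric section of `F` has integral at most `M`, then along any injective linear map
the integral of `F` is controlled by that of the indicator of the unit ball. -/
theorem lintegral_comp_mul_le {F : Euc n → ℝ≥0∞} {M : ℝ≥0∞}
    (hM : ∀ V : Euc m →ₗᵢ[ℝ] Euc n, ∫⁻ h, F (V h) ≤ M)
    (A : Euc m →ₗ[ℝ] Euc n) (hA : Function.Injective A) :
    volume (closedBall (0 : Euc m) 1) * ∫⁻ h, F (A h) ≤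
      M * ∫⁻ h, (closedBall (0 : Euc n) 1).indicator 1 (A h) := by
  obtain ⟨c, -, V, hc⟩ := exists_lintegral_comp_eq A hA
  rw [hc, hc]
  -- The ball has the same section by every subspace, so its integral along `A` determines the
  -- Jacobian `c`.
  have hball : ∫⁻ h, (closedBall (0 : Euc n) 1).indicator (1 : Euc n → ℝ≥0∞) (V h) =
      volume (closedBall (0 : Euc m) 1) := by
    rw [← lintegral_indicator_one measurableSet_closedBall]
    congr 1 with h
    simp [indicator]
  rw [hball]
  calc _ = c * volume (closedBall (0 : Euc m) 1) * ∫⁻ h, F (V h) := by ring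
    _ ≤ c * volume (closedBall (0 : Euc m) 1) * M := by gcongr; exact hM V
    _ = _ := by ring

theorem sectionMeasure_eq (f : Euc n → ℝ) {K : Set (Euc n)}
    (V : Euc m →ₗᵢ[ℝ] Euc n) :
    sectionMeasure f K (LinearMap.range V.toLinearMap) = ∫ h in {h : Euc m | V h ∈ K}, f (V h) := by
  set L : Euc m ≃ₗᵢ[ℝ] LinearMap.range V.toLinearMap := V.equivRange
  rw [sectionMeasure, ← map_eq_subspaceVolume _ L]
  exact L.toHomeomorph.measurableEmbedding.setIntegral_map _ _

theorem exists_eq_range (H : Submodule ℝ (Euc n)) (hH : Module.finrank ℝ H = m) :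
    ∃ V : Euc m →ₗᵢ[ℝ] Euc n, H = LinearMap.range V.toLinearMap := by
  refine ⟨H.subtypeₗᵢ.comp (subspaceParam H hH).toLinearIsometry, ?_⟩
  ext x
  simp only [LinearMap.mem_range]
  constructor
  · intro hx
    exact ⟨(subspaceParam H hH).symm ⟨x, hx⟩, by simp⟩
  · rintro ⟨y, rfl⟩
    exact (subspaceParam H hH y).2

theorem finrank_range_isometry (V : Euc m →ₗᵢ[ℝ] Euc n) :
    Module.finrank ℝ (LinearMap.range V.toLinearMap) = m := by
  rw [← V.equivRange.toLinearEquiv.finrank_eq, finrank_euclideanSpace_fin]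

end LinearSections

/-! ### Polar coordinates and averaging over the orthogonal group -/

section Averaging

variable {n m : ℕ}

theorem lintegral_polar (hn : 0 < n) {g : Euc n → ℝ≥0∞} (hg : Measurable g) :
    ∫⁻ x, g x = ∫⁻ ξ : sphere (0 : Euc n) 1, (∫⁻ t in Ioi (0 : ℝ),
      ENNReal.ofReal (t ^ (n - 1)) * g (t • (ξ : Euc n))) ∂(volume : Measure (Euc n)).toSphere := by
  have : Nonempty (Fin n) := ⟨⟨0, hn⟩⟩
  have hmp := (volume : Measure (Euc n)).measurePreserving_homeomorphUnitSphereProd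
  rw [finrank_euclideanSpace_fin] at hmp
  have hG : Measurable fun p : sphere (0 : Euc n) 1 × Ioi (0 : ℝ) =>
      g ((p.2 : ℝ) • (p.1 : Euc n)) := by
    refine hg.comp (Continuous.measurable ?_)
    fun_prop
  calc ∫⁻ x, g x = ∫⁻ x : ({0}ᶜ : Set (Euc n)), g x ∂(volume.comap Subtype.val) := by
        rw [lintegral_subtype_comap (measurableSet_singleton _).compl g, restrict_compl_singleton]
    _ = ∫⁻ p, g ((p.2 : ℝ) • (p.1 : Euc n))
          ∂((volume : Measure (Euc n)).toSphere.prod (Measure.volumeIoiPow (n - 1))) := by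
        rw [← hmp.lintegral_comp hG]
        congr 1 with x
        have hx : ‖(x : Euc n)‖ ≠ 0 := norm_ne_zero_iff.2 x.2
        simp [smul_smul, mul_inv_cancel₀ hx]
    _ = _ := by
        rw [lintegral_prod _ hG.aemeasurable]
        congr 1 with ξ
        rw [Measure.volumeIoiPow, lintegral_withDensity_eq_lintegral_mul]
        · exact lintegral_subtype_comap measurableSet_Ioi
            (fun t : ℝ => ENNReal.ofReal (t ^ (n - 1)) * g (t • (ξ : Euc n)))
        · fun_prop
        · exact hG.comp measurable_prodMk_left

instance : ContinuousStar (Euc n →L[ℝ] Euc n) :=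
  ⟨(ContinuousLinearMap.adjoint (𝕜 := ℝ) (E := Euc n) (F := Euc n)).continuous⟩

/-- The orthogonal group of `ℝⁿ`. -/
def OrthGroup (n : ℕ) : Type := unitary (Euc n →L[ℝ] Euc n)

namespace OrthGroup

instance : Group (OrthGroup n) := inferInstanceAs (Group (unitary (Euc n →L[ℝ] Euc n)))

instance : TopologicalSpace (OrthGroup n) :=
  inferInstanceAs (TopologicalSpace (unitary (Euc n →L[ℝ] Euc n)))

instance : IsTopologicalGroup (OrthGroup n) :=
  inferInstanceAs (IsTopologicalGroup (unitary (Euc n →L[ℝ] Euc n)))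

instance : SecondCountableTopology (OrthGroup n) :=
  inferInstanceAs (SecondCountableTopology (unitary (Euc n →L[ℝ] Euc n)))

instance : MeasurableSpace (OrthGroup n) := borel _

instance : BorelSpace (OrthGroup n) := ⟨rfl⟩

/-- The action of the orthogonal group on `ℝⁿ`. -/
def toIsometry (U : OrthGroup n) : Euc n ≃ₗᵢ[ℝ] Euc n :=
  Unitary.linearIsometryEquiv (H := Euc n) (𝕜 := ℝ) U

theorem toIsometry_mul (U V : OrthGroup n) (x : Euc n) :
    (U * V).toIsometry x = U.toIsometry (V.toIsometry x) := rfl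

theorem continuous_toIsometry :
    Continuous fun p : OrthGroup n × Euc n => p.1.toIsometry p.2 := by
  have h : Continuous fun U : OrthGroup n => (Subtype.val U : Euc n →L[ℝ] Euc n) :=
    continuous_subtype_val
  exact (h.comp continuous_fst).clm_apply continuous_snd

instance : CompactSpace (OrthGroup n) := by
  refine isCompact_iff_compactSpace.1 (isCompact_of_isClosed_isBounded
    (s := ((unitary (Euc n →L[ℝ] Euc n) : Submonoid _) : Set (Euc n →L[ℝ] Euc n))) ?_ ?_)
  · have : ((unitary (Euc n →L[ℝ] Euc n) : Submonoid _) : Set (Euc n →L[ℝ] Euc n)) =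
        {U | star U * U = 1} ∩ {U | U * star U = 1} := by
      ext U; exact Unitary.mem_iff
    rw [this]
    exact (isClosed_eq (continuous_star.mul continuous_id) continuous_const).inter
      (isClosed_eq (continuous_id.mul continuous_star) continuous_const)
  · refine isBounded_iff_forall_norm_le.2 ⟨1, fun U hU => ?_⟩
    refine ContinuousLinearMap.opNorm_le_bound _ zero_le_one fun x => ?_
    rw [one_mul]
    exact ((toIsometry (n := n) ⟨U, hU⟩).norm_map x).le

theorem exists_toIsometry_eq (e : Euc n ≃ₗᵢ[ℝ] Euc n) : ∃ U : OrthGroup n, U.toIsometry = e :=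
  ⟨(Unitary.linearIsometryEquiv (H := Euc n) (𝕜 := ℝ)).symm e,
    (Unitary.linearIsometryEquiv (H := Euc n) (𝕜 := ℝ)).apply_symm_apply e⟩

theorem exists_apply_eq {x y : Euc n} (h : ‖x‖ = ‖y‖) :
    ∃ U : OrthGroup n, U.toIsometry x = y := by
  obtain ⟨U, hU⟩ := exists_toIsometry_eq (Submodule.reflection (ℝ ∙ (x - y))ᗮ)
  exact ⟨U, by rw [hU]; exact Submodule.reflection_sub h⟩

/-- Extend the isometry `V ∘ W⁻¹` from the range of `W` to the whole space. -/
theorem exists_apply_isometry (V W : Euc m →ₗᵢ[ℝ] Euc n) :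
    ∃ U : OrthGroup n, ∀ h, U.toIsometry (W h) = V h := by
  set L : LinearMap.range W.toLinearMap →ₗᵢ[ℝ] Euc n :=
    V.comp W.equivRange.symm.toLinearIsometry
  obtain ⟨U, hU⟩ := exists_toIsometry_eq (L.extend.toLinearIsometryEquiv rfl)
  refine ⟨U, fun h => ?_⟩
  have h1 : L.extend (W.equivRange h : Euc n) = L (W.equivRange h) := L.extend_apply _
  have h2 : L (W.equivRange h) = V h := by simp [L]
  rw [hU]
  exact h1.trans h2

end OrthGroup

/-- Normalized Haar measure on the orthogonal group. -/
def orthHaar (n : ℕ) : Measure (OrthGroup n) := Measure.haarMeasure ⊤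

instance : IsProbabilityMeasure (orthHaar n) :=
  ⟨Measure.haarMeasure_self (K₀ := (⊤ : TopologicalSpace.PositiveCompacts (OrthGroup n)))⟩

instance : (orthHaar n).IsMulLeftInvariant := by unfold orthHaar; infer_instance

/-- The average of a function over the orbits of the orthogonal group. -/
def orthAverage (G : Euc n → ℝ≥0∞) (y : Euc n) : ℝ≥0∞ :=
  ∫⁻ U : OrthGroup n, G (U⁻¹.toIsometry y) ∂(orthHaar n)

theorem measurable_orthGroup_apply {G : Euc n → ℝ≥0∞} (hG : Measurable G) :
    Measurable fun p : OrthGroup n × Euc n => G (p.1⁻¹.toIsometry p.2) :=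
  hG.comp (OrthGroup.continuous_toIsometry.comp
    ((continuous_inv.comp continuous_fst).prodMk continuous_snd)).measurable

theorem measurable_orthGroup_apply_left {G : Euc n → ℝ≥0∞} (hG : Measurable G) (y : Euc n) :
    Measurable fun U : OrthGroup n => G (U⁻¹.toIsometry y) :=
  hG.comp (OrthGroup.continuous_toIsometry.comp
    (continuous_inv.prodMk (continuous_const (y := y)))).measurable

/-- Rotations act transitively on spheres, and left invariance of Haar measure absorbs the rotation.
-/
theorem orthAverage_eq_of_norm_eq (G : Euc n → ℝ≥0∞) {x y : Euc n} (h : ‖x‖ = ‖y‖) :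
    orthAverage G x = orthAverage G y := by
  obtain ⟨V, rfl⟩ := OrthGroup.exists_apply_eq h
  unfold orthAverage
  rw [← lintegral_mul_left_eq_self
    (fun U : OrthGroup n => G (U⁻¹.toIsometry (V.toIsometry x))) V]
  congr 1 with U
  rw [← OrthGroup.toIsometry_mul]
  congr 3
  group

theorem measurable_orthAverage {G : Euc n → ℝ≥0∞} (hG : Measurable G) :
    Measurable (orthAverage G) :=
  (measurable_orthGroup_apply hG).lintegral_prod_left'

/-- Volume and the radial weight are both rotation invariant, so `G` may be rotated freely, then
averaged by Tonelli. -/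
theorem lintegral_mul_orthAverage {G : Euc n → ℝ≥0∞} (hG : Measurable G) {w : ℝ → ℝ≥0∞}
    (hw : Measurable w) :
    ∫⁻ y, w ‖y‖ * G y = ∫⁻ y, w ‖y‖ * orthAverage G y := by
  have h1 : ∀ U : OrthGroup n, ∫⁻ y, w ‖y‖ * G y =
      ∫⁻ y, w ‖y‖ * G (U⁻¹.toIsometry y) := by
    intro U
    set e := U⁻¹.toIsometry
    have := e.measurePreserving.lintegral_comp (f := fun y => w ‖y‖ * G y) (by fun_prop)
    rw [← this]
    congr 1 with y
    rw [e.norm_map]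
  have h2 : Measurable (Function.uncurry fun (U : OrthGroup n) (y : Euc n) =>
      w ‖y‖ * G (U⁻¹.toIsometry y)) :=
    (hw.comp measurable_snd.norm).mul (measurable_orthGroup_apply hG)
  calc ∫⁻ y, w ‖y‖ * G y = ∫⁻ _ : OrthGroup n, ∫⁻ y, w ‖y‖ * G y ∂volume ∂(orthHaar n) := by simp
    _ = ∫⁻ U : OrthGroup n, ∫⁻ y, w ‖y‖ * G (U⁻¹.toIsometry y)
        ∂volume ∂(orthHaar n) := lintegral_congr h1
    _ = ∫⁻ y, ∫⁻ U : OrthGroup n, w ‖y‖ * G (U⁻¹.toIsometry y)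
        ∂(orthHaar n) := by
      exact lintegral_lintegral_swap h2.aemeasurable
    _ = _ := by
      congr 1 with y
      exact lintegral_const_mul _ (measurable_orthGroup_apply_left hG y)

theorem lintegral_rotationInvariant (hn : 0 < n) {φ : Euc n → ℝ≥0∞} (hφ : Measurable φ)
    (hinv : ∀ x y, ‖x‖ = ‖y‖ → φ x = φ y) {e : Euc n} (he : ‖e‖ = 1) :
    ∫⁻ x, φ x = (volume : Measure (Euc n)).toSphere univ *
      ∫⁻ t in Ioi (0 : ℝ), ENNReal.ofReal (t ^ (n - 1)) * φ (t • e) := by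
  rw [lintegral_polar hn hφ]
  have : ∀ ξ : sphere (0 : Euc n) 1, ∀ t : ℝ, φ (t • (ξ : Euc n)) = φ (t • e) := by
    intro ξ t
    refine hinv _ _ ?_
    rw [norm_smul, norm_smul, he, norm_eq_of_mem_sphere]
  simp_rw [this]
  rw [lintegral_const, mul_comm]

/-- Integration against `‖y‖⁻ᵏ` is, up to a constant, averaging over random sections of
codimension `k`. -/
theorem exists_lintegral_eq_average {k : ℕ} (hk : k < n) (ι : Euc (n - k) →ₗᵢ[ℝ] Euc n) :
    ∃ c : ℝ≥0∞, ∀ G : Euc n → ℝ≥0∞, Measurable G →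
      ∫⁻ y, ENNReal.ofReal (‖y‖⁻¹ ^ k) * G y = c * ∫⁻ U : OrthGroup n,
        ∫⁻ h, G (U⁻¹.toIsometry (ι h)) ∂volume ∂(orthHaar n) := by
  have hn : 0 < n := by omega
  have hm : 0 < n - k := by omega
  set σn := (volume : Measure (Euc n)).toSphere univ
  set σm := (volume : Measure (Euc (n - k))).toSphere univ
  have hσm : σm ≠ 0 := by
    have : Nonempty (Fin (n - k)) := ⟨⟨0, hm⟩⟩
    simp only [σm, ne_eq, Measure.measure_univ_eq_zero]
    exact Measure.toSphere_ne_zero _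
  have hσm' : σm ≠ ∞ := measure_ne_top _ _
  -- Both sides become the same radial integral of the average of `G`, so the constant is the ratio
  -- of the sphere areas.
  refine ⟨σn / σm, fun G hG => ?_⟩
  have hw : Measurable fun t : ℝ => ENNReal.ofReal (t⁻¹ ^ k) := by fun_prop
  rw [lintegral_mul_orthAverage hG hw]
  have hav := measurable_orthAverage hG
  set e' : Euc (n - k) := EuclideanSpace.single ⟨0, hm⟩ 1
  have he' : ‖e'‖ = 1 := by simp [e']
  have he : ‖ι e'‖ = 1 := by rw [ι.norm_map, he']
  have h1 := lintegral_rotationInvariant hn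
    (φ := fun y => ENNReal.ofReal (‖y‖⁻¹ ^ k) * orthAverage G y) (by fun_prop)
    (fun x y h => by rw [h, orthAverage_eq_of_norm_eq G h]) he
  have h2 := lintegral_rotationInvariant hm (φ := fun h => orthAverage G (ι h))
    (hav.comp ι.continuous.measurable)
    (fun x y h => orthAverage_eq_of_norm_eq G (by rw [ι.norm_map, ι.norm_map, h])) he'
  have h4 : Measurable (Function.uncurry fun (U : OrthGroup n) (h : Euc (n - k)) =>
      G (U⁻¹.toIsometry (ι h))) :=
    hG.comp (OrthGroup.continuous_toIsometry.comp
      ((continuous_inv.comp continuous_fst).prodMk (ι.continuous.comp continuous_snd))).measurable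
  have h3 : ∫⁻ U : OrthGroup n, ∫⁻ h, G (U⁻¹.toIsometry (ι h))
      ∂volume ∂(orthHaar n) = ∫⁻ h, orthAverage G (ι h) := by
    exact lintegral_lintegral_swap h4.aemeasurable
  rw [h1, h3, h2, ← mul_assoc, ENNReal.div_mul_cancel hσm hσm']
  congr 1
  refine setLIntegral_congr_fun measurableSet_Ioi fun t ht => ?_
  have ht' : (0 : ℝ) < t := ht
  simp only [norm_smul, he, mul_one, Real.norm_of_nonneg ht'.le, map_smul]
  rw [← mul_assoc, ← ENNReal.ofReal_mul (by positivity)]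
  congr 2
  -- The weight `t^(-k)` converts the polar density of `ℝⁿ` into that of `ℝ^(n-k)`.
  rw [show n - 1 = (n - k - 1) + k by omega, pow_add, mul_assoc, ← mul_pow,
    mul_inv_cancel₀ ht'.ne', one_pow, mul_one]

end Averaging

/-! ### Weighted comparison: ellipsoids, radial sums, limits -/

section WeightedComparison

variable {n k : ℕ}

theorem exists_linearIsometry {m : ℕ} (hmn : m ≤ n) : Nonempty (Euc m →ₗᵢ[ℝ] Euc n) := by
  have hli : LinearIndependent ℝ fun i : Fin m =>
      EuclideanSpace.basisFun (Fin n) ℝ (Fin.castLE hmn i) :=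
    (EuclideanSpace.basisFun (Fin n) ℝ).orthonormal.linearIndependent.comp _
      (Fin.castLE_injective hmn)
  obtain ⟨V, -⟩ := exists_eq_range (m := m) _
    ((finrank_span_eq_card hli).trans (Fintype.card_fin m))
  exact ⟨V⟩

theorem lintegral_comp_linearEquiv (T : Euc n ≃ₗ[ℝ] Euc n) (g : Euc n → ℝ≥0∞) :
    ∫⁻ x, g x = ENNReal.ofReal |LinearMap.det (T : Euc n →ₗ[ℝ] Euc n)| * ∫⁻ y, g (T y) := by
  have hdet : LinearMap.det (T : Euc n →ₗ[ℝ] Euc n) ≠ 0 := T.isUnit_det'.ne_zero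
  have h2 := Measure.map_linearMap_addHaar_eq_smul_addHaar (volume : Measure (Euc n)) hdet
  have h3 : ∫⁻ x, g x ∂(volume.map (T : Euc n →ₗ[ℝ] Euc n)) = ∫⁻ y, g (T y) :=
    lintegral_map_equiv (μ := (volume : Measure (Euc n))) g
      T.toContinuousLinearEquiv.toHomeomorph.toMeasurableEquiv
  rw [← h3, h2, lintegral_smul_measure, smul_eq_mul, ← mul_assoc, ← ENNReal.ofReal_mul
    (abs_nonneg _), ← abs_mul, mul_inv_cancel₀ hdet, abs_one, ENNReal.ofReal_one, one_mul]

/-- The map `T` reduces the weight to `‖y‖^(-k)`; the determinant and the averaging constant occur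
on both sides, and the sections are compared rotation by rotation. -/
theorem lintegral_ellipsoid_mul_le (hk : k < n) {F : Euc n → ℝ≥0∞} (hF : Measurable F) {M : ℝ≥0∞}
    (hM : ∀ V : Euc (n - k) →ₗᵢ[ℝ] Euc n, ∫⁻ h, F (V h) ≤ M)
    {E : Set (Euc n)} (hE : IsSymmEllipsoid E) :
    volume (closedBall (0 : Euc (n - k)) 1) *
        ∫⁻ x, ENNReal.ofReal (radialFunction E x ^ k) * F x ≤
      M * ∫⁻ x, ENNReal.ofReal (radialFunction E x ^ k) *
        (closedBall (0 : Euc n) 1).indicator 1 x := by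
  obtain ⟨T, rfl⟩ := hE
  obtain ⟨ι⟩ := exists_linearIsometry (Nat.sub_le n k)
  obtain ⟨c, hc⟩ := exists_lintegral_eq_average hk ι
  have hT : Measurable T := T.toContinuousLinearEquiv.continuous.measurable
  have hB : Measurable ((closedBall (0 : Euc n) 1).indicator (1 : Euc n → ℝ≥0∞)) :=
    measurable_one.indicator measurableSet_closedBall
  simp_rw [radialFunction_ellipsoid]
  rw [lintegral_comp_linearEquiv T fun x => ENNReal.ofReal (‖T.symm x‖⁻¹ ^ k) * F x,
    lintegral_comp_linearEquiv T fun x => ENNReal.ofReal (‖T.symm x‖⁻¹ ^ k) *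
      (closedBall (0 : Euc n) 1).indicator 1 x]
  simp_rw [LinearEquiv.symm_apply_apply]
  have e1 := hc (fun y => F (T y)) (hF.comp hT)
  have e2 := hc (fun y => (closedBall (0 : Euc n) 1).indicator 1 (T y)) (hB.comp hT)
  rw [e1, e2, mul_left_comm, mul_left_comm M]
  refine mul_le_mul_right ?_ _
  rw [mul_left_comm, mul_left_comm M]
  refine mul_le_mul_right ?_ _
  have hUle : ∀ U : OrthGroup n,
      volume (closedBall (0 : Euc (n - k)) 1) * ∫⁻ h, F (T (U⁻¹.toIsometry (ι h))) ≤
        M * ∫⁻ h, (closedBall (0 : Euc n) 1).indicator 1 (T (U⁻¹.toIsometry (ι h))) := by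
    intro U
    exact lintegral_comp_mul_le hM
      (T.toLinearMap ∘ₗ U⁻¹.toIsometry.toLinearEquiv.toLinearMap ∘ₗ ι.toLinearMap)
      (T.injective.comp (U⁻¹.toIsometry.injective.comp ι.injective))
  calc _ ≤ ∫⁻ U : OrthGroup n, volume (closedBall (0 : Euc (n - k)) 1) *
        ∫⁻ h, F (T (U⁻¹.toIsometry (ι h))) ∂volume ∂(orthHaar n) :=
        lintegral_const_mul_le _ _
    _ ≤ ∫⁻ U : OrthGroup n, M * ∫⁻ h, (closedBall (0 : Euc n) 1).indicator 1
        (T (U⁻¹.toIsometry (ι h))) ∂volume ∂(orthHaar n) := lintegral_mono hUle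
    _ = _ := by
      refine lintegral_const_mul _ ?_
      have h4 : Measurable (Function.uncurry fun (U : OrthGroup n) (h : Euc (n - k)) =>
          (closedBall (0 : Euc n) 1).indicator (1 : Euc n → ℝ≥0∞)
            (T (U⁻¹.toIsometry (ι h)))) :=
        (hB.comp hT).comp (OrthGroup.continuous_toIsometry.comp
          ((continuous_inv.comp continuous_fst).prodMk
            (ι.continuous.comp continuous_snd))).measurable
      exact h4.lintegral_prod_right'

theorem IsRadialSum.radialFunction_pow (hk : 1 ≤ k) {m : ℕ} {E : Fin m → Set (Euc n)}
    {L : Set (Euc n)} (h : IsRadialSum k E L) (x : Euc n) :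
    radialFunction L x ^ k = ∑ i, radialFunction (E i) x ^ k := by
  rcases eq_or_ne x 0 with rfl | hx
  · simp [radialFunction_zero, show k ≠ 0 by omega]
  · rw [radialFunction_eq_inv_norm_mul hx, mul_pow, h.2 _ (inv_norm_smul_mem_sphere hx),
      Finset.mul_sum]
    refine Finset.sum_congr rfl fun i _ => ?_
    rw [radialFunction_eq_inv_norm_mul (K := E i) hx, mul_pow]

theorem IsSymmEllipsoid.measurable_radialFunction {E : Set (Euc n)} (hE : IsSymmEllipsoid E) :
    Measurable (radialFunction E) := by
  obtain ⟨T, rfl⟩ := hE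
  have : radialFunction (T '' closedBall (0 : Euc n) 1) = fun x => ‖T.symm x‖⁻¹ :=
    funext (radialFunction_ellipsoid T)
  rw [this]
  exact (T.symm.toContinuousLinearEquiv.continuous.measurable.norm).inv

theorem IsSymmEllipsoid.radialFunction_nonneg {E : Set (Euc n)} (hE : IsSymmEllipsoid E)
    (x : Euc n) : 0 ≤ radialFunction E x := by
  obtain ⟨T, rfl⟩ := hE
  rw [radialFunction_ellipsoid]
  positivity

theorem lintegral_radialSum_mul_le (hk1 : 1 ≤ k) (hk : k < n) {F : Euc n → ℝ≥0∞}
    (hF : Measurable F) {M : ℝ≥0∞}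
    (hM : ∀ V : Euc (n - k) →ₗᵢ[ℝ] Euc n, ∫⁻ h, F (V h) ≤ M)
    {m : ℕ} {E : Fin m → Set (Euc n)} (hE : ∀ i, IsSymmEllipsoid (E i)) {L : Set (Euc n)}
    (hL : IsRadialSum k E L) :
    volume (closedBall (0 : Euc (n - k)) 1) *
        ∫⁻ x, ENNReal.ofReal (radialFunction L x ^ k) * F x ≤
      M * ∫⁻ x, ENNReal.ofReal (radialFunction L x ^ k) *
        (closedBall (0 : Euc n) 1).indicator 1 x := by
  have hsum : ∀ G : Euc n → ℝ≥0∞, Measurable G →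
      ∫⁻ x, ENNReal.ofReal (radialFunction L x ^ k) * G x =
        ∑ i, ∫⁻ x, ENNReal.ofReal (radialFunction (E i) x ^ k) * G x := by
    intro G hG
    have hEG : ∀ i, Measurable fun x => ENNReal.ofReal (radialFunction (E i) x ^ k) * G x :=
      fun i => ((hE i).measurable_radialFunction.pow_const k).ennreal_ofReal.mul hG
    rw [← lintegral_finsetSum _ fun i _ => hEG i]
    refine lintegral_congr fun x => ?_
    rw [hL.radialFunction_pow hk1, ENNReal.ofReal_sum_of_nonneg fun i _ =>
      pow_nonneg ((hE i).radialFunction_nonneg x) k, Finset.sum_mul]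
  rw [hsum F hF, hsum _ (measurable_one.indicator measurableSet_closedBall), Finset.mul_sum,
    Finset.mul_sum]
  exact Finset.sum_le_sum fun i _ => lintegral_ellipsoid_mul_le hk hF hM (hE i)

/-- The comparison of weighted integrals for generalized `k`-intersection bodies. -/
theorem IsGenIntersectionBody.lintegral_mul_le (hk1 : 1 ≤ k) (hk : k < n) {F : Euc n → ℝ≥0∞}
    (hF : Measurable F) {M : ℝ≥0∞}
    (hM : ∀ V : Euc (n - k) →ₗᵢ[ℝ] Euc n, ∫⁻ h, F (V h) ≤ M)
    {D : Set (Euc n)} (hD : IsGenIntersectionBody k D) :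
    volume (closedBall (0 : Euc (n - k)) 1) *
        ∫⁻ x, ENNReal.ofReal (radialFunction D x ^ k) * F x ≤
      M * ∫⁻ x, ENNReal.ofReal (radialFunction D x ^ k) *
        (closedBall (0 : Euc n) 1).indicator 1 x := by
  obtain ⟨⟨hDs, -⟩, happ⟩ := hD
  set X := volume (closedBall (0 : Euc (n - k)) 1) *
        ∫⁻ x, ENNReal.ofReal (radialFunction D x ^ k) * F x with hX
  set Y := M * ∫⁻ x, ENNReal.ofReal (radialFunction D x ^ k) *
        (closedBall (0 : Euc n) 1).indicator 1 x with hY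
  have hB : Measurable ((closedBall (0 : Euc n) 1).indicator (1 : Euc n → ℝ≥0∞)) :=
    measurable_one.indicator measurableSet_closedBall
  have hw : Measurable fun x => ENNReal.ofReal (radialFunction D x ^ k) :=
    (hDs.measurable_radialFunction.pow_const k).ennreal_ofReal
  have hwF : Measurable fun x => ENNReal.ofReal (radialFunction D x ^ k) * F x := hw.mul hF
  have hwB : Measurable fun x => ENNReal.ofReal (radialFunction D x ^ k) *
      (closedBall (0 : Euc n) 1).indicator 1 x := hw.mul hB
  -- An approximating radial sum has radius within factors `1 ± η` of that of `D`; the loss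
  -- disappears as `η → 0`.
  have key : ∀ η : ℝ, 0 < η → η < 1 →
      ENNReal.ofReal ((1 - η) ^ k) * X ≤ ENNReal.ofReal ((1 + η) ^ k) * Y := by
    intro η h0 h1
    obtain ⟨ε, hε, hεD⟩ := exists_radialDist_lt_imp hDs h0
    obtain ⟨m, E, L, -, hE, hL, hdist⟩ := happ ε hε
    have hle := hεD L hL.1 hdist
    calc ENNReal.ofReal ((1 - η) ^ k) * X
        = volume (closedBall (0 : Euc (n - k)) 1) * ∫⁻ x, ENNReal.ofReal ((1 - η) ^ k) *
          (ENNReal.ofReal (radialFunction D x ^ k) * F x) := by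
          rw [lintegral_const_mul _ hwF, hX, mul_left_comm]
      _ ≤ volume (closedBall (0 : Euc (n - k)) 1) *
          ∫⁻ x, ENNReal.ofReal (radialFunction L x ^ k) * F x := by
          refine mul_le_mul_right (lintegral_mono fun x => ?_) _
          rw [← mul_assoc, ← ENNReal.ofReal_mul (pow_nonneg (by linarith) _), ← mul_pow]
          gcongr
          · exact mul_nonneg (by linarith) (hDs.radialFunction_nonneg x)
          · exact (hle x).1
      _ ≤ M * ∫⁻ x, ENNReal.ofReal (radialFunction L x ^ k) *
          (closedBall (0 : Euc n) 1).indicator 1 x :=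
          lintegral_radialSum_mul_le hk1 hk hF hM hE hL
      _ ≤ M * ∫⁻ x, ENNReal.ofReal ((1 + η) ^ k) * (ENNReal.ofReal (radialFunction D x ^ k) *
          (closedBall (0 : Euc n) 1).indicator 1 x) := by
          refine mul_le_mul_right (lintegral_mono fun x => ?_) _
          rw [← mul_assoc, ← ENNReal.ofReal_mul (pow_nonneg (by linarith) _), ← mul_pow]
          gcongr
          · exact hL.1.radialFunction_nonneg x
          · exact (hle x).2
      _ = _ := by rw [lintegral_const_mul _ hwB, hY, mul_left_comm]
  have lim : ∀ (s : ℝ) (Z : ℝ≥0∞), Filter.Tendsto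
      (fun η : ℝ => ENNReal.ofReal ((1 + s * η) ^ k) * Z) (nhdsWithin 0 (Ioi 0)) (nhds Z) := by
    intro s Z
    have hc : Continuous fun η : ℝ => ENNReal.ofReal ((1 + s * η) ^ k) :=
      ENNReal.continuous_ofReal.comp (by fun_prop)
    have ht := (hc.tendsto 0).mono_left (nhdsWithin_le_nhds (s := Ioi 0))
    simp only [mul_zero, add_zero, one_pow, ENNReal.ofReal_one] at ht
    -- The factor tends to 1, which is nonzero, so `Z = ∞` is harmless.
    simpa using ENNReal.Tendsto.mul_const (b := Z) ht (Or.inl one_ne_zero)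
  refine le_of_tendsto_of_tendsto (lim (-1) X) (lim 1 Y) ?_
  filter_upwards [Ioo_mem_nhdsGT (show (0 : ℝ) < 1 by norm_num)] with η hη
  have := key η hη.1 hη.2
  rwa [sub_eq_add_neg, neg_eq_neg_one_mul, ← one_mul ((1 + η) ^ k), one_mul,
    show (1 : ℝ) + η = 1 + 1 * η by ring] at this

end WeightedComparison

/-! ### Radial integrals, volume and Hölder on the sphere -/

section Holder

variable {n k : ℕ}

theorem lintegral_pow_indicator_Iic (j : ℕ) {a : ℝ} (ha : 0 ≤ a) :
    ∫⁻ t in Ioi (0 : ℝ), ENNReal.ofReal (t ^ j) * (Iic a).indicator 1 t =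
      ENNReal.ofReal (a ^ (j + 1) / (j + 1)) := by
  have h1 : ∀ t : ℝ, ENNReal.ofReal (t ^ j) * (Iic a).indicator 1 t =
      (Iic a).indicator (fun t => ENNReal.ofReal (t ^ j)) t := by
    intro t
    by_cases h : t ∈ Iic a <;> simp [h]
  simp_rw [h1]
  rw [lintegral_indicator measurableSet_Iic, Measure.restrict_restrict measurableSet_Iic,
    inter_comm, Ioi_inter_Iic, ← ofReal_integral_eq_lintegral_ofReal
      (intervalIntegral.intervalIntegrable_pow _).1, ← intervalIntegral.integral_of_le ha]
  · simp
  · filter_upwards [ae_restrict_mem measurableSet_Ioc] with y hy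
    exact pow_nonneg hy.1.le _

/-- By homogeneity the radial integrand is `t^(n-k-1)` on `[0, 1]`, whose integral is `1 / (n - k)`.
-/
theorem IsStarBody.lintegral_radialFunction_ball (hk : k < n) {D : Set (Euc n)}
    (hD : IsStarBody D) :
    ∫⁻ x, ENNReal.ofReal (radialFunction D x ^ k) * (closedBall (0 : Euc n) 1).indicator 1 x =
      ENNReal.ofReal (1 / ((n : ℝ) - k)) * ∫⁻ ξ : sphere (0 : Euc n) 1,
        ENNReal.ofReal (radialFunction D ξ ^ k) ∂(volume : Measure (Euc n)).toSphere := by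
  have hw : Measurable fun x => ENNReal.ofReal (radialFunction D x ^ k) :=
    (hD.measurable_radialFunction.pow_const k).ennreal_ofReal
  have hwB : Measurable fun x => ENNReal.ofReal (radialFunction D x ^ k) *
      (closedBall (0 : Euc n) 1).indicator 1 x :=
    hw.mul (measurable_one.indicator measurableSet_closedBall)
  rw [lintegral_polar (by omega) hwB,
    ← lintegral_const_mul' _ _ ENNReal.ofReal_ne_top]
  refine lintegral_congr fun ξ => ?_
  have h2 := lintegral_pow_indicator_Iic (n - k - 1) zero_le_one
  have h3 : ((n - k - 1 : ℕ) : ℝ) + 1 = (n : ℝ) - k := by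
    rw [← Nat.cast_sub hk.le, ← Nat.cast_add_one, Nat.sub_add_cancel (by omega)]
  rw [one_pow, h3] at h2
  rw [← h2, mul_comm, ← lintegral_const_mul]
  · refine setLIntegral_congr_fun measurableSet_Ioi fun t ht => ?_
    have ht' : (0 : ℝ) < t := ht
    simp only [radialFunction_smul ht']
    have h4 : (closedBall (0 : Euc n) 1).indicator (1 : Euc n → ℝ≥0∞) (t • (ξ : Euc n)) =
        (Iic (1 : ℝ)).indicator 1 t := by
      have : t • (ξ : Euc n) ∈ closedBall (0 : Euc n) 1 ↔ t ∈ Iic (1 : ℝ) := by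
        rw [mem_closedBall_zero_iff, norm_smul, norm_eq_of_mem_sphere, mul_one,
          Real.norm_of_nonneg ht'.le, mem_Iic]
      by_cases h : t ∈ Iic (1 : ℝ)
      · rw [indicator_of_mem h, indicator_of_mem (this.2 h)]; rfl
      · rw [indicator_of_notMem h, indicator_of_notMem (mt this.1 h)]
    rw [h4, ← mul_assoc, ← mul_assoc, ← ENNReal.ofReal_mul (by positivity),
      ← ENNReal.ofReal_mul (pow_nonneg (hD.radialFunction_nonneg _) _)]
    congr 2
    rw [mul_pow, ← mul_assoc, show n - 1 = (n - k - 1) + k by omega, pow_add, mul_assoc (t ^ _),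
      ← mul_pow, mul_inv_cancel₀ ht'.ne', one_pow, mul_one, mul_comm]
  · exact (by fun_prop : Measurable fun t : ℝ => ENNReal.ofReal (t ^ (n - k - 1))).mul
      (measurable_one.indicator measurableSet_Iic)

theorem IsStarBody.volume_eq (hn : 0 < n) {D : Set (Euc n)} (hD : IsStarBody D) :
    (n : ℝ≥0∞) * volume D = ∫⁻ ξ : sphere (0 : Euc n) 1,
      ENNReal.ofReal (radialFunction D ξ ^ n) ∂(volume : Measure (Euc n)).toSphere := by
  have hw : Measurable fun x => ENNReal.ofReal (radialFunction D x ^ n) :=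
    (hD.measurable_radialFunction.pow_const n).ennreal_ofReal
  rw [← lintegral_indicator_one hD.isClosed.measurableSet,
    lintegral_polar hn (measurable_one.indicator hD.isClosed.measurableSet),
    ← lintegral_const_mul']
  swap
  · exact ENNReal.natCast_ne_top n
  refine lintegral_congr fun ξ => ?_
  have hξ : (ξ : Euc n) ≠ 0 := ne_zero_of_mem_unit_sphere ξ
  have h2 := lintegral_pow_indicator_Iic (n - 1) (hD.radialFunction_nonneg ξ)
  have h3 : ((n - 1 : ℕ) : ℝ) + 1 = n := by
    rw [← Nat.cast_add_one, Nat.sub_add_cancel hn]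
  have h5 : ∫⁻ t in Ioi (0 : ℝ), ENNReal.ofReal (t ^ (n - 1)) *
      D.indicator 1 (t • (ξ : Euc n)) = ENNReal.ofReal (radialFunction D ξ ^ n / n) := by
    rw [h3, Nat.sub_add_cancel hn] at h2
    rw [← h2]
    refine setLIntegral_congr_fun measurableSet_Ioi fun t ht => ?_
    have ht' : (0 : ℝ) < t := ht
    have := hD.smul_mem_iff hξ ht'.le
    simp only [indicator, mem_Iic, this, Pi.one_apply]
  rw [h5, ← ENNReal.ofReal_natCast, ← ENNReal.ofReal_mul (by positivity),
    mul_div_cancel₀ _ (by positivity)]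

theorem IsStarBody.lintegral_radialFunction_pow_le (hk1 : 1 ≤ k) (hk : k < n) {D : Set (Euc n)}
    (hD : IsStarBody D) :
    ∫⁻ ξ : sphere (0 : Euc n) 1, ENNReal.ofReal (radialFunction D ξ ^ k)
        ∂(volume : Measure (Euc n)).toSphere ≤
      (n * volume (closedBall (0 : Euc n) 1)) ^ (((n : ℝ) - k) / n) *
        (n * volume D) ^ ((k : ℝ) / n) := by
  have hk0 : (0 : ℝ) < k := by exact_mod_cast hk1
  have hkn : (k : ℝ) < n := by exact_mod_cast hk
  have hn0 : (0 : ℝ) < n := hk0.trans hkn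
  have hnk : (0 : ℝ) < n - k := by linarith
  -- Exponent `n / k` raises `r_D^k` to `r_D^n`, the volume integrand; the other factor is the
  -- constant 1, which contributes the sphere area `n |B|`.
  have hpq : ((n : ℝ) / k).HolderConjugate (n / (n - k)) := by
    rw [Real.holderConjugate_iff]
    refine ⟨(one_lt_div hk0).2 hkn, ?_⟩
    field_simp
    ring
  have hw : Measurable fun x => ENNReal.ofReal (radialFunction D x ^ k) :=
    (hD.measurable_radialFunction.pow_const k).ennreal_ofReal
  have hol := ENNReal.lintegral_mul_le_Lp_mul_Lq (volume : Measure (Euc n)).toSphere hpq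
    (f := fun ξ : sphere (0 : Euc n) 1 => ENNReal.ofReal (radialFunction D ξ ^ k)) (g := 1)
    (hw.comp measurable_subtype_coe).aemeasurable aemeasurable_one
  simp only [Pi.mul_apply, Pi.one_apply, mul_one, ENNReal.one_rpow, lintegral_one, one_div_div,
    Measure.toSphere_apply_univ, finrank_euclideanSpace_fin] at hol
  have : Nonempty (Fin n) := ⟨⟨0, by omega⟩⟩
  rw [hD.volume_eq (by omega), Measure.addHaar_closedBall_eq_addHaar_ball, mul_comm]
  refine hol.trans_eq ?_
  congr 2
  refine lintegral_congr fun ξ => ?_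
  rw [ENNReal.ofReal_rpow_of_nonneg (pow_nonneg (hD.radialFunction_nonneg _) _) (by positivity),
    ← Real.rpow_natCast, ← Real.rpow_mul (hD.radialFunction_nonneg _),
    mul_div_cancel₀ _ hk0.ne', Real.rpow_natCast]

end Holder

/-! ### Existence of a maximal section -/

section Attainment

variable {n m : ℕ} {K : Set (Euc n)} {f : Euc n → ℝ}

theorem ContinuousOn.measurable_indicator_of_isClosed (hf : ContinuousOn f K) (hK : IsClosed K) :
    Measurable (K.indicator f) := by
  classical
  rw [← piecewise_eq_indicator]
  exact hf.measurable_piecewise continuousOn_const hK.measurableSet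

theorem ContinuousOn.continuousAt_indicator_of_notMem_frontier (hf : ContinuousOn f K)
    (hK : IsClosed K) {x : Euc n} (hx : x ∉ frontier K) : ContinuousAt (K.indicator f) x := by
  by_cases hxK : x ∈ K
  · have hi : x ∈ interior K := by
      by_contra h
      exact hx (hK.frontier_eq ▸ ⟨hxK, h⟩)
    have hn : K ∈ nhds x := mem_interior_iff_mem_nhds.1 hi
    refine (hf.continuousAt hn).congr ?_
    filter_upwards [hn] with y hy
    rw [indicator_of_mem hy]
  · refine (continuousAt_const (y := (0 : ℝ))).congr ?_
    filter_upwards [hK.isOpen_compl.mem_nhds hxK] with y hy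
    rw [indicator_of_notMem hy]

/-- The bound depends on `‖x‖` only, so a single function dominates the integrands of all rotated
sections. -/
theorem IsStarBody.exists_indicator_bound (hK : IsStarBody K) (hf : ContinuousOn f K) :
    ∃ C R : ℝ, ∀ x, ‖K.indicator f x‖ ≤ (Iic R).indicator (fun _ => C) ‖x‖ := by
  have hKc : IsCompact K := isCompact_of_isClosed_isBounded hK.isClosed hK.isBounded
  obtain ⟨C, hC⟩ := hKc.exists_bound_of_continuousOn hf
  obtain ⟨R, hR⟩ := hK.isBounded.exists_norm_le
  have hC0 : 0 ≤ C := (norm_nonneg _).trans (hC 0 (interior_subset hK.zero_mem_interior))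
  refine ⟨C, R, fun x => ?_⟩
  by_cases hx : x ∈ K
  · rw [indicator_of_mem hx, indicator_of_mem (show ‖x‖ ∈ Iic R from hR x hx)]
    exact hC x hx
  · rw [indicator_of_notMem hx, norm_zero]
    exact indicator_nonneg (fun _ _ => hC0) _

theorem integrable_indicator_norm (C R : ℝ) :
    Integrable fun h : Euc m => (Iic R).indicator (fun _ => C) ‖h‖ := by
  have : (fun h : Euc m => (Iic R).indicator (fun _ => C) ‖h‖) =
      (closedBall (0 : Euc m) R).indicator fun _ => C := by
    ext h
    simp [indicator]
  rw [this, integrable_indicator_iff measurableSet_closedBall]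
  exact integrableOn_const measure_closedBall_lt_top.ne

theorem IsStarBody.integrable_indicator_comp (hK : IsStarBody K) (hf : ContinuousOn f K)
    (V : Euc m →ₗᵢ[ℝ] Euc n) : Integrable fun h => K.indicator f (V h) := by
  obtain ⟨C, R, hCR⟩ := hK.exists_indicator_bound hf
  refine (integrable_indicator_norm C R).mono' ?_ (ae_of_all _ fun h => ?_)
  · exact ((hf.measurable_indicator_of_isClosed hK.isClosed).comp
      V.continuous.measurable).aestronglyMeasurable
  · simpa using hCR (V h)

theorem IsStarBody.sectionMeasure_eq_integral (hK : IsStarBody K) (V : Euc m →ₗᵢ[ℝ] Euc n) :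
    sectionMeasure f K (LinearMap.range V.toLinearMap) = ∫ h, K.indicator f (V h) := by
  rw [sectionMeasure_eq, ← integral_indicator
    (show MeasurableSet {h : Euc m | V h ∈ K} from
      V.continuous.measurable hK.isClosed.measurableSet)]
  rfl

/-- Dominated convergence: `f · 1_K` can be discontinuous only on the boundary of `K`, which is null
in each section. -/
theorem IsStarBody.continuous_integral_rotation (hK : IsStarBody K) (hf : ContinuousOn f K)
    (ι : Euc m →ₗᵢ[ℝ] Euc n) :
    Continuous fun U : OrthGroup n => ∫ h, K.indicator f (U.toIsometry (ι h)) := by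
  obtain ⟨C, R, hCR⟩ := hK.exists_indicator_bound hf
  refine continuous_iff_continuousAt.2 fun U => ?_
  refine continuousAt_of_dominated (bound := fun h => (Iic R).indicator (fun _ => C) ‖h‖)
    (Filter.Eventually.of_forall fun W => ?_) (Filter.Eventually.of_forall fun W =>
      ae_of_all _ fun h => ?_) (integrable_indicator_norm C R) ?_
  · exact ((hf.measurable_indicator_of_isClosed hK.isClosed).comp
      (W.toIsometry.continuous.comp ι.continuous).measurable).aestronglyMeasurable
  · simpa using hCR (W.toIsometry (ι h))
  · have hnull := hK.volume_frontier_comp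
      (U.toIsometry.toLinearEquiv.toLinearMap ∘ₗ ι.toLinearMap)
      (U.toIsometry.injective.comp ι.injective)
    have hae : ∀ᵐ h : Euc m, U.toIsometry (ι h) ∉ frontier K := by
      rw [ae_iff]
      simpa using hnull
    filter_upwards [hae] with h hh
    have h1 : Continuous fun W : OrthGroup n => W.toIsometry (ι h) :=
      OrthGroup.continuous_toIsometry.comp (continuous_id.prodMk (continuous_const (y := ι h)))
    exact ContinuousAt.comp (f := fun W : OrthGroup n => W.toIsometry (ι h))
      (hf.continuousAt_indicator_of_notMem_frontier hK.isClosed hh) h1.continuousAt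

/-- The maximal section measure is attained. -/
theorem IsStarBody.exists_isGreatest_sectionMeasure (hK : IsStarBody K) (hf : ContinuousOn f K)
    (hmn : m ≤ n) :
    ∃ M : ℝ, IsGreatest {s : ℝ | ∃ H : Submodule ℝ (Euc n),
      Module.finrank ℝ H = m ∧ s = sectionMeasure f K H} M := by
  obtain ⟨ι⟩ := exists_linearIsometry hmn
  obtain ⟨U, -, hU⟩ := isCompact_univ.exists_isMaxOn univ_nonempty
    (hK.continuous_integral_rotation hf ι).continuousOn
  refine ⟨_, ⟨LinearMap.range (U.toIsometry.toLinearIsometry.comp ι).toLinearMap,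
    finrank_range_isometry _, (hK.sectionMeasure_eq_integral _).symm⟩, ?_⟩
  rintro s ⟨H, hH, rfl⟩
  obtain ⟨V, rfl⟩ := exists_eq_range H hH
  -- Every section is a rotation of the fixed one, so the maximum over the group is the maximum over
  -- all subspaces.
  obtain ⟨W, hW⟩ := OrthGroup.exists_apply_isometry V ι
  rw [hK.sectionMeasure_eq_integral]
  simp_rw [← hW]
  exact hU (mem_univ W)

end Attainment

/-! ### The volume bound and the infimum over containing bodies -/

section Main

variable {n k : ℕ} {K D : Set (Euc n)} {f : Euc n → ℝ}

theorem lintegral_le_lintegral_radialFunction_mul (hn : 0 < n) (hD : IsStarBody D) (hKD : K ⊆ D)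
    {F : Euc n → ℝ≥0∞} (hF : ∀ x ∉ K, F x = 0) :
    ∫⁻ x, F x ≤ ∫⁻ x, ENNReal.ofReal (radialFunction D x ^ k) * F x := by
  have : Nonempty (Fin n) := ⟨⟨0, hn⟩⟩
  -- The origin must be left out: the extended radius is 0 there.
  have hae : ∀ᵐ x : Euc n, x ≠ 0 := by simp [ae_iff]
  refine lintegral_mono_ae ?_
  filter_upwards [hae] with x hx
  by_cases hxK : x ∈ K
  · refine le_mul_of_one_le_left zero_le ?_
    rw [ENNReal.one_le_ofReal]
    exact one_le_pow₀ (hD.one_le_radialFunction hx (hKD hxK))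
  · simp [hF x hxK]

/-- The volume estimate for a fixed generalized intersection body containing `K`. -/
theorem densityMeasure_le_of_subset (hk1 : 1 ≤ k) (hk : k < n) (hK : IsStarBody K)
    (hf : ContinuousOn f K) (hf0 : ∀ x ∈ K, 0 ≤ f x) {M : ℝ} (hM0 : 0 ≤ M)
    (hM : ∀ V : Euc (n - k) →ₗᵢ[ℝ] Euc n, ∫ h, K.indicator f (V h) ≤ M)
    (hD : IsGenIntersectionBody k D) (hKD : K ⊆ D) :
    densityMeasure f K ≤ (n : ℝ) / ((n : ℝ) - k) * cConst n k * M * vol D ^ ((k : ℝ) / n) := by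
  have hk0 : (0 : ℝ) < k := by exact_mod_cast hk1
  have hkn : (k : ℝ) < n := by exact_mod_cast hk
  have hn0 : (0 : ℝ) < n := hk0.trans hkn
  have hnk : (0 : ℝ) < n - k := by linarith
  have hind0 : ∀ x, 0 ≤ K.indicator f x := indicator_nonneg hf0
  set F : Euc n → ℝ≥0∞ := fun x => ENNReal.ofReal (K.indicator f x) with hFdef
  have hF : Measurable F := (hf.measurable_indicator_of_isClosed hK.isClosed).ennreal_ofReal
  have hFM : ∀ V : Euc (n - k) →ₗᵢ[ℝ] Euc n, ∫⁻ h, F (V h) ≤ ENNReal.ofReal M := by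
    intro V
    rw [← ofReal_integral_eq_lintegral_ofReal (hK.integrable_indicator_comp hf V)
      (ae_of_all _ fun h => hind0 _)]
    exact ENNReal.ofReal_le_ofReal (hM V)
  have hFK : ∫⁻ x, F x = ENNReal.ofReal (densityMeasure f K) := by
    rw [densityMeasure, ← integral_indicator hK.isClosed.measurableSet]
    exact (ofReal_integral_eq_lintegral_ofReal
      (hK.integrable_indicator_comp hf LinearIsometry.id) (ae_of_all _ fun h => hind0 _)).symm
  have hDs := hD.1.1
  have h1 := hD.lintegral_mul_le hk1 hk hF hFM
  have h2 := lintegral_le_lintegral_radialFunction_mul (k := k) (by omega) hDs hKD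
    (F := F) fun x hx => by simp [hFdef, hx]
  have h3 := hDs.lintegral_radialFunction_pow_le hk1 hk
  rw [hDs.lintegral_radialFunction_ball hk] at h1
  set Bm := volume (closedBall (0 : Euc (n - k)) 1) with hBm
  have hBm0 : Bm ≠ 0 := (measure_closedBall_pos _ _ one_pos).ne'
  have hBmt : Bm ≠ ∞ := measure_closedBall_lt_top.ne
  have hBnt : volume (closedBall (0 : Euc n) 1) ≠ ∞ := measure_closedBall_lt_top.ne
  have hDt : volume D ≠ ∞ := hDs.isBounded.measure_lt_top.ne
  have h4 : Bm * ENNReal.ofReal (densityMeasure f K) ≤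
      ENNReal.ofReal M * (ENNReal.ofReal (1 / ((n : ℝ) - k)) *
        ((n * volume (closedBall (0 : Euc n) 1)) ^ (((n : ℝ) - k) / n) *
          (n * volume D) ^ ((k : ℝ) / n))) := by
    rw [← hFK]
    exact (mul_le_mul_right h2 _).trans (h1.trans (by gcongr))
  have hd0 : 0 ≤ densityMeasure f K :=
    setIntegral_nonneg hK.isClosed.measurableSet hf0
  have h5 := ENNReal.toReal_mono (by
    refine ENNReal.mul_ne_top ENNReal.ofReal_ne_top (ENNReal.mul_ne_top ENNReal.ofReal_ne_top
      (ENNReal.mul_ne_top ?_ ?_))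
    · exact ENNReal.rpow_ne_top_of_nonneg (by positivity)
        (ENNReal.mul_ne_top (ENNReal.natCast_ne_top n) hBnt)
    · exact ENNReal.rpow_ne_top_of_nonneg (by positivity)
        (ENNReal.mul_ne_top (ENNReal.natCast_ne_top n) hDt)) h4
  simp only [ENNReal.toReal_mul, ← ENNReal.toReal_rpow, ENNReal.toReal_natCast,
    ENNReal.toReal_ofReal hd0, ENNReal.toReal_ofReal hM0,
    ENNReal.toReal_ofReal (one_div_nonneg.2 hnk.le)] at h5
  have hBmr : 0 < Bm.toReal := ENNReal.toReal_pos hBm0 hBmt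
  rw [Real.mul_rpow hn0.le ENNReal.toReal_nonneg, Real.mul_rpow hn0.le ENNReal.toReal_nonneg] at h5
  -- The powers of `n` from the two Hölder factors combine into the numerator of `n / (n - k)`.
  have hnn : (n : ℝ) ^ (((n : ℝ) - k) / n) * (n : ℝ) ^ ((k : ℝ) / n) = n := by
    rw [← Real.rpow_add hn0, ← add_div, sub_add_cancel, div_self hn0.ne', Real.rpow_one]
  rw [cConst, vol, vol, vol, ← hBm]
  set X := (volume (closedBall (0 : Euc n) 1)).toReal ^ (((n : ℝ) - k) / n)
  set Y := (volume D).toReal ^ ((k : ℝ) / n)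
  have h6 : densityMeasure f K * Bm.toReal ≤ (n : ℝ) / ((n : ℝ) - k) * X * M * Y := by
    calc _ = Bm.toReal * densityMeasure f K := mul_comm _ _
      _ ≤ _ := h5
      _ = ((n : ℝ) ^ (((n : ℝ) - k) / n) * (n : ℝ) ^ ((k : ℝ) / n)) *
          (1 / ((n : ℝ) - k)) * X * M * Y := by ring
      _ = _ := by rw [hnn]; ring
  rw [← le_div_iff₀ hBmr] at h6
  exact h6.trans_eq (by ring)

/-- A large ball is itself in the class. Without a competitor the infimum would take the default
value 0. -/
theorem outerVolumeRatio_set_nonempty (hK : IsStarBody K) :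
    {v : ℝ | ∃ D : Set (Euc n), K ⊆ D ∧ IsGenIntersectionBody k D ∧
      v = (vol D / vol K) ^ (1 / (n : ℝ))}.Nonempty := by
  obtain ⟨R, hR0, hR⟩ := hK.isBounded.exists_pos_norm_le
  exact ⟨_, closedBall 0 R, fun x hx => by simpa using hR x hx,
    isGenIntersectionBody_closedBall k hR0, rfl⟩

/-- The inequality is a closed condition on `v` and the infimum lies in the closure of `S`, so no
minimizer is needed. -/
theorem le_csInf_pow_mul {S : Set ℝ} (hS : S.Nonempty) (hS0 : ∀ v ∈ S, 0 ≤ v) {a C : ℝ}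
    (h : ∀ v ∈ S, a ≤ v ^ k * C) : a ≤ sInf S ^ k * C := by
  have hcont : Continuous fun v : ℝ => v ^ k * C := by fun_prop
  have hcl : sInf S ∈ closure S := csInf_mem_closure hS ⟨0, hS0⟩
  exact closure_minimal (fun v hv => h v hv) (isClosed_le continuous_const hcont) hcl

end Main

end

theorem corollary1 (n k : ℕ) (hk : 1 ≤ k) (hkn : k ≤ n - 1)
    (K : Set (Euc n)) (hK : IsSymmStarBody K)
    (f : Euc n → ℝ) (hf_cont : ContinuousOn f K)
    (hf_nonneg : ∀ x ∈ K, 0 ≤ f x) (hf_even : ∀ x ∈ K, f (-x) = f x) :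
    ∃ M : ℝ,
      IsGreatest {s : ℝ | ∃ H : Submodule ℝ (Euc n),
        Module.finrank ℝ H = n - k ∧ s = sectionMeasure f K H} M ∧
      densityMeasure f K ≤
        outerVolumeRatio k K ^ k * ((n : ℝ) / ((n : ℝ) - (k : ℝ))) * cConst n k * M *
          vol K ^ ((k : ℝ) / (n : ℝ)) := by
  have hkn' : k < n := by omega
  have hKs := hK.1
  obtain ⟨M, hM⟩ := hKs.exists_isGreatest_sectionMeasure hf_cont (Nat.sub_le n k)
  refine ⟨M, hM, ?_⟩
  have hMV : ∀ V : Euc (n - k) →ₗᵢ[ℝ] Euc n, ∫ h, K.indicator f (V h) ≤ M := fun V =>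
    hM.2 ⟨_, finrank_range_isometry V, (hKs.sectionMeasure_eq_integral V).symm⟩
  have hM0 : 0 ≤ M := by
    obtain ⟨V⟩ := exists_linearIsometry (Nat.sub_le n k)
    exact (integral_nonneg fun h => indicator_nonneg hf_nonneg _).trans (hMV V)
  have hvK : 0 < vol K := ENNReal.toReal_pos
    (Measure.measure_pos_of_mem_nhds _ (mem_interior_iff_mem_nhds.1 hKs.zero_mem_interior)).ne'
    hKs.isBounded.measure_lt_top.ne
  have hn0 : (0 : ℝ) < n := by exact_mod_cast (by omega : 0 < n)
  have hmain : densityMeasure f K ≤ outerVolumeRatio k K ^ k *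
      ((n : ℝ) / ((n : ℝ) - (k : ℝ)) * cConst n k * M * vol K ^ ((k : ℝ) / (n : ℝ))) := by
    refine le_csInf_pow_mul (outerVolumeRatio_set_nonempty hKs) ?_ ?_
    · rintro v ⟨D, -, -, rfl⟩
      exact Real.rpow_nonneg (div_nonneg ENNReal.toReal_nonneg hvK.le) _
    · rintro v ⟨D, hKD, hD, rfl⟩
      refine (densityMeasure_le_of_subset hk hkn' hKs hf_cont hf_nonneg hM0 hMV hD hKD).trans_eq ?_
      have hvD : 0 ≤ vol D := ENNReal.toReal_nonneg
      -- The `k`-th power of the ratio is `(|D| / |K|)^(k/n)`, so the factor `|K|^(k/n)` cancels and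
      -- leaves `|D|^(k/n)`.
      rw [← Real.rpow_natCast, ← Real.rpow_mul (div_nonneg hvD hvK.le), one_div_mul_eq_div,
        Real.div_rpow hvD hvK.le]
      have : vol K ^ ((k : ℝ) / n) ≠ 0 := (Real.rpow_pos_of_pos hvK _).ne'
      field_simp
  exact hmain.trans_eq (by ring)
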